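/- Let $n,m\ge 1$ be integers, let $1\le k\le\min\{n,m\}$, and let $\Sigma_0\in\mathbb{R}^{n\times n}$ be symmetric with $n$ distinct positive eigenvalues. Let $\Sigma_0=\Omega\Lambda\Omega^\top$ be a spectral decomposition with $\Omega$ orthogonal and $\Lambda=\operatorname{diag}(\lambda_1,\dots,\lambda_n)$, $\lambda_1>\dots>\lambda_n>0$. For $W\in\mathbb{R}^{n\times m}$ define the Bures–Wasserstein loss $$L^1(W)=\operatorname{tr}\Big(WW^\top+\Sigma_0-2\big(\Sigma_0^{1/2}WW^\top\Sigma_0^{1/2}\big)^{1/2}\Big),$$ where $A^{1/2}$ is the positive semidefinite square root of a positive semidefinite matrix $A$. Let $\mathcal{M}(k)$ be the manifold of real $n\times m$ matrices of rank exactly $k$, and $\mathcal{M}(\leqslant k)$ the set of those of rank at most $k$. For $J\subseteq[n]=\{1,\dots,n\}$ with $|J|=k$, let $\Omega_J\in\mathbb{R}^{n\times k}$ consist of the columns of $\Omega$ with index in $J$ and $\bar\Lambda_J\in\mathbb{R}^{k\times k}$ of the rows and columns of $\Lambda$ with index in $J$ (both in increasing order of the index). Then the following hold. 1. The restriction $L^1|_{\mathcal{M}(k)}$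 is differentiable, and $W$ is a critical point of it (that is, $W\in\mathcal{M}(k)$ and the differential of $L^1|_{\mathcal{M}(k)}$ at $W$ vanishes on the tangent space of $\mathcal{M}(k)$ at $W$) if and only if $$W=\Omega_J\,\bar\Lambda_J^{1/2}\,V^\top$$ for some $J\subseteq[n]$ with $|J|=k$ and some $V\in\mathbb{R}^{m\times k}$ with $V^\top V=I_k$. 2. The minimum of $L^1$ over $\mathcal{M}(\leqslant k)$ is attained precisely when $J=[k]$: a matrix $\Omega_J\bar\Lambda_J^{1/2}V^\top$ as in 1 is a minimizer of $L^1$ over $\mathcal{M}(\leqslant k)$ if and only if $J=[k]$, and the minimizers of $L^1$ over $\mathcal{M}(\leqslant k)$ are exactly the matrices $\Omega_{[k]}\bar\Lambda_{[k]}^{1/2}V^\top$ with $V\in\mathbb{R}^{m\times k}$, $V^\top V=I_k$. 3. In particular, the infimum of $L^1$ over $\mathcal{M}(k)$ is attained, and $$\inf_{\mathcal{M}(k)}L^1=\min_{\mathcal{M}(k)}L^1=\min_{\mathcal{M}(\leqslant k)}L^1.$$ -/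

import Mathlib

open scoped MatrixOrder Matrix

noncomputable section

namespace BuresWasserstein

/-- The squared Bures-Wasserstein distance between positive semidefinite matrices; `CFC.sqrt` is the
positive semidefinite square root. -/
def buresSq {n : ℕ} (S S₀ : Matrix (Fin n) (Fin n) ℝ) : ℝ :=
  (S + S₀ - (2 : ℝ) • CFC.sqrt (CFC.sqrt S₀ * S * CFC.sqrt S₀)).trace

/-- The loss in function space, `W ↦ B²(W Wᵀ, Σ₀)`. -/
def lossOne {n m : ℕ} (S₀ : Matrix (Fin n) (Fin n) ℝ) (W : Matrix (Fin n) (Fin m) ℝ) : ℝ :=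
  buresSq (W * Wᵀ) S₀

/-- The real `n × m` matrices of rank exactly `k`. -/
def rankEq (k n m : ℕ) : Set (Matrix (Fin n) (Fin m) ℝ) := {W | W.rank = k}

/-- The real `n × m` matrices of rank at most `k`. -/
def rankLE (k n m : ℕ) : Set (Matrix (Fin n) (Fin m) ℝ) := {W | W.rank ≤ k}

/-- `W` is a critical point of the restriction of `f` to the embedded submanifold `M`: the
restriction is differentiable at `W` and its differential vanishes on the tangent space to `M`
at `W`. (At points of an embedded submanifold, `tangentConeAt` is the tangent space, and the values
there of a derivative within `M` are determined by the restriction of `f` to `M`. No norm has to be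
chosen: derivatives are taken in the topological vector space of matrices.) -/
def IsCriticalPointOn {n m : ℕ} (f : Matrix (Fin n) (Fin m) ℝ → ℝ)
    (M : Set (Matrix (Fin n) (Fin m) ℝ)) (W : Matrix (Fin n) (Fin m) ℝ) : Prop :=
  W ∈ M ∧ ∃ f' : Matrix (Fin n) (Fin m) ℝ →L[ℝ] ℝ,
    HasFDerivWithinAt f f' M W ∧ ∀ H ∈ tangentConeAt ℝ M W, f' H = 0

/-- The columns of `A` with index in `J`, in increasing order. -/
def columns {n k : ℕ} (A : Matrix (Fin n) (Fin n) ℝ) (J : Finset (Fin n)) (hJ : J.card = k) :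
    Matrix (Fin n) (Fin k) ℝ :=
  A.submatrix id (J.orderEmbOfFin hJ)

/-- The rows and columns of `A` with index in `J`, in increasing order. -/
def principal {n k : ℕ} (A : Matrix (Fin n) (Fin n) ℝ) (J : Finset (Fin n)) (hJ : J.card = k) :
    Matrix (Fin k) (Fin k) ℝ :=
  A.submatrix (J.orderEmbOfFin hJ) (J.orderEmbOfFin hJ)

/-- The matrix `Ω_J (Λ_J)^{1/2} Vᵀ`. -/
def candidate {n m k : ℕ} (Ω Λ : Matrix (Fin n) (Fin n) ℝ) (J : Finset (Fin n)) (hJ : J.card = k)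
    (V : Matrix (Fin m) (Fin k) ℝ) : Matrix (Fin n) (Fin m) ℝ :=
  columns Ω J hJ * CFC.sqrt (principal Λ J hJ) * Vᵀ

/-- The set of the first `k` indices. -/
def firstIndices (n k : ℕ) : Finset (Fin n) := Finset.univ.filter fun i => i.val < k

theorem card_firstIndices {n k : ℕ} (h : k ≤ n) : (firstIndices n k).card = k := by
  simp [firstIndices, Fin.card_filter_val_lt, h]

end BuresWasserstein

end

/-! Put `A = Σ₀^{1/2}`. The loss is `‖W‖² + tr Σ₀ - 2‖AW‖_*`, with the Frobenius norm and the
nuclear norm. Everything is read off a compact singular value decomposition `AW = U diag(s) Vᵀ`.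

Differentiability. The nuclear norm dominates the linear functional `X ↦ tr(V Uᵀ X)`, with equality
at `AW`. Conversely, `2‖BDᵀ‖_* ≤ ‖B‖² + ‖D‖²`. On matrices of rank exactly `k` near `W`, `AY`
factors as `B(Y) D(Y)ᵀ` with `B`, `D` differentiable at `W` and the upper bound sharp there. So the
error of the linear approximation lies between zero and a nonnegative differentiable function
vanishing at `W`, and has zero derivative. This gives the gradient `2(W - A U Vᵀ)` in
`hasFDerivWithinAt_lossOne`.

Critical points. Testing the gradient on the tangent directions `P W` alone yields `Σ₀ U = U
diag(s)` (`eigen_of_stationary`). Since the eigenvalues of `Σ₀` are distinct, `U Uᵀ` is diagonal in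
the basis `Ω` with entries 0 and 1, which is the set `J`. Then `W = A U Vᵀ` fixes `W Wᵀ`, hence `W`
up to the choice of `V`.

Minimizers. Completing the square (`lossOne_eq_of_isCompactSVD`) writes the loss as `‖W - A U Vᵀ‖² +
∑ λᵢ - ∑ λᵢ pᵢ`, where `pᵢ` is the diagonal of the projection `U Uᵀ` in the basis `Ω`. These `pᵢ`
lie in `[0, 1]` and sum to at most `k`, so a linear program (`sum_mul_le_sum_firstIndices`) gives
the bound and its equality case. -/

namespace BuresWasserstein

/-! ### Square roots and compact singular value decompositions -/

/-- A compact singular value decomposition `X = U diag(s) Vᵀ` with positive singular values. -/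
structure IsCompactSVD {n m : ℕ} {ι : Type*} [Fintype ι] [DecidableEq ι]
    (X : Matrix (Fin n) (Fin m) ℝ) (U : Matrix (Fin n) ι ℝ) (s : ι → ℝ)
    (V : Matrix (Fin m) ι ℝ) : Prop where
  left_orthonormal : Uᵀ * U = 1
  right_orthonormal : Vᵀ * V = 1
  pos : ∀ i, 0 < s i
  eq : X = U * Matrix.diagonal s * Vᵀ

theorem trace_transpose_mul_self_nonneg {p q : Type*} [Fintype p] [Fintype q]
    (A : Matrix p q ℝ) : 0 ≤ (Aᵀ * A).trace := by
  simpa using (Matrix.posSemidef_conjTranspose_mul_self A).trace_nonneg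

theorem trace_transpose_mul_self_eq_zero_iff {p q : Type*} [Fintype p] [Fintype q]
    {A : Matrix p q ℝ} : (Aᵀ * A).trace = 0 ↔ A = 0 := by
  simpa using Matrix.trace_conjTranspose_mul_self_eq_zero_iff (A := A)

theorem self_mul_transpose_eq_zero {p q : Type*} [Fintype p] [Fintype q]
    {A : Matrix p q ℝ} : A * Aᵀ = 0 ↔ A = 0 := by
  simpa using Matrix.self_mul_conjTranspose_eq_zero (A := A)

theorem sqrt_eq_of_mul_self {p : Type*} [Fintype p] [DecidableEq p] {A B : Matrix p p ℝ}
    (hB : B.PosSemidef) (h : B * B = A) : CFC.sqrt A = B :=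
  CFC.sqrt_unique h (Matrix.nonneg_iff_posSemidef.mpr hB)

theorem posSemidef_conj_diagonal {p q : Type*} [Fintype p] [Fintype q] [DecidableEq q]
    (U : Matrix p q ℝ) {s : q → ℝ} (hs : ∀ i, 0 ≤ s i) :
    (U * Matrix.diagonal s * Uᵀ).PosSemidef := by
  simpa using (Matrix.PosSemidef.diagonal (d := s) hs).mul_mul_conjTranspose_same U

theorem conj_diagonal_mul_conj_diagonal {p q : Type*} [Fintype p] [Fintype q] [DecidableEq q]
    {U : Matrix p q ℝ} (hU : Uᵀ * U = 1) (s t : q → ℝ) :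
    U * Matrix.diagonal s * Uᵀ * (U * Matrix.diagonal t * Uᵀ)
      = U * Matrix.diagonal (fun i => s i * t i) * Uᵀ := by
  rw [← Matrix.diagonal_mul_diagonal]
  calc U * Matrix.diagonal s * Uᵀ * (U * Matrix.diagonal t * Uᵀ)
      = U * Matrix.diagonal s * (Uᵀ * U) * Matrix.diagonal t * Uᵀ := by
        simp only [Matrix.mul_assoc]
    _ = _ := by rw [hU]; simp only [Matrix.mul_one, Matrix.mul_assoc]

theorem sqrt_conj_diagonal {p q : Type*} [Fintype p] [DecidableEq p] [Fintype q] [DecidableEq q]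
    {U : Matrix p q ℝ} (hU : Uᵀ * U = 1) {s : q → ℝ} (hs : ∀ i, 0 ≤ s i) :
    CFC.sqrt (U * Matrix.diagonal s * Uᵀ) = U * Matrix.diagonal (fun i => √(s i)) * Uᵀ := by
  refine sqrt_eq_of_mul_self (posSemidef_conj_diagonal U fun i => Real.sqrt_nonneg _) ?_
  rw [conj_diagonal_mul_conj_diagonal hU]
  simp only [Real.mul_self_sqrt (hs _)]

theorem sqrt_diagonal {q : Type*} [Fintype q] [DecidableEq q] {s : q → ℝ} (hs : ∀ i, 0 ≤ s i) :
    CFC.sqrt (Matrix.diagonal s) = Matrix.diagonal (fun i => √(s i)) := by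
  simpa using sqrt_conj_diagonal (U := (1 : Matrix q q ℝ)) (by simp) hs

theorem trace_conj_diagonal {p q : Type*} [Fintype p] [Fintype q] [DecidableEq q]
    {U : Matrix p q ℝ} (hU : Uᵀ * U = 1) (s : q → ℝ) :
    (U * Matrix.diagonal s * Uᵀ).trace = ∑ i, s i := by
  rw [Matrix.trace_mul_comm, ← Matrix.mul_assoc, hU, Matrix.one_mul, Matrix.trace_diagonal]

namespace IsCompactSVD

variable {n m : ℕ} {ι : Type*} [Fintype ι] [DecidableEq ι] {X : Matrix (Fin n) (Fin m) ℝ}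
  {U : Matrix (Fin n) ι ℝ} {s : ι → ℝ} {V : Matrix (Fin m) ι ℝ}

theorem mul_transpose_eq (h : IsCompactSVD X U s V) :
    X * Xᵀ = U * Matrix.diagonal (fun i => s i * s i) * Uᵀ := by
  rw [← Matrix.diagonal_mul_diagonal]
  calc X * Xᵀ = U * Matrix.diagonal s * (Vᵀ * V) * Matrix.diagonal s * Uᵀ := by
        rw [h.eq]; simp [Matrix.mul_assoc]
    _ = _ := by rw [h.right_orthonormal]; simp only [Matrix.mul_one, Matrix.mul_assoc]

theorem trace_sqrt (h : IsCompactSVD X U s V) :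
    (CFC.sqrt (X * Xᵀ)).trace = ∑ i, s i := by
  rw [h.mul_transpose_eq, sqrt_conj_diagonal h.left_orthonormal fun i => mul_self_nonneg _,
    trace_conj_diagonal h.left_orthonormal]
  exact Finset.sum_congr rfl fun i _ => Real.sqrt_mul_self (h.pos i).le

theorem compress_eq (h : IsCompactSVD X U s V) : Uᵀ * X * V = Matrix.diagonal s := by
  calc Uᵀ * X * V = (Uᵀ * U) * Matrix.diagonal s * (Vᵀ * V) := by
        rw [h.eq]; simp only [Matrix.mul_assoc]
    _ = _ := by rw [h.left_orthonormal, h.right_orthonormal]; simp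

theorem trace_pairing (h : IsCompactSVD X U s V) : (V * Uᵀ * X).trace = ∑ i, s i := by
  rw [Matrix.mul_assoc, Matrix.trace_mul_comm, h.compress_eq, Matrix.trace_diagonal]

theorem rank_eq (h : IsCompactSVD X U s V) : X.rank = Fintype.card ι := by
  apply le_antisymm
  · rw [h.eq]
    exact (Matrix.rank_mul_le_left _ _).trans
      ((Matrix.rank_mul_le_left _ _).trans (Matrix.rank_le_card_width _))
  · have hr : (Matrix.diagonal s).rank = Fintype.card ι := by
      apply Matrix.rank_of_isUnit
      rw [Matrix.isUnit_iff_isUnit_det, Matrix.det_diagonal, isUnit_iff_ne_zero]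
      exact Finset.prod_ne_zero_iff.mpr fun i _ => (h.pos i).ne'
    rw [← hr, ← h.compress_eq]
    exact (Matrix.rank_mul_le_left _ _).trans (Matrix.rank_mul_le_right _ _)

end IsCompactSVD

/-- The right factor must be `V = Xᵀ U diag(s)⁻¹`. Besides producing decompositions, this recovers
`W` from `W Wᵀ` up to the choice of `V`. -/
theorem exists_isCompactSVD_of_mul_transpose_eq {n m : ℕ} {ι : Type*} [Fintype ι] [DecidableEq ι]
    {X : Matrix (Fin n) (Fin m) ℝ} {U : Matrix (Fin n) ι ℝ} {s : ι → ℝ} (hU : Uᵀ * U = 1)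
    (hs : ∀ i, 0 < s i) (hX : X * Xᵀ = U * Matrix.diagonal (fun i => s i * s i) * Uᵀ) :
    ∃ V : Matrix (Fin m) ι ℝ, IsCompactSVD X U s V := by
  set S : Matrix _ _ ℝ := Matrix.diagonal s with hSdef
  set T : Matrix _ _ ℝ := Matrix.diagonal fun i => (s i)⁻¹ with hTdef
  have hSS : X * Xᵀ = U * (S * S) * Uᵀ := by
    rw [hX, hSdef, Matrix.diagonal_mul_diagonal]
  have hTS : T * S = 1 := by
    rw [hSdef, hTdef, Matrix.diagonal_mul_diagonal, ← Matrix.diagonal_one]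
    congr 1; funext i; exact inv_mul_cancel₀ (hs i).ne'
  have hST : S * T = 1 := mul_eq_one_comm.mp hTS
  have hTt : Tᵀ = T := Matrix.diagonal_transpose _
  -- The columns of `X` lie in the span of `U`: the residual times its own transpose vanishes.
  have hproj : X - U * Uᵀ * X = 0 := by
    rw [← self_mul_transpose_eq_zero]
    have h1 : (X - U * Uᵀ * X) * (X - U * Uᵀ * X)ᵀ
        = (X * Xᵀ - U * Uᵀ * (X * Xᵀ)) * (1 - U * Uᵀ) := by
      simp [Matrix.sub_mul, Matrix.mul_sub, Matrix.mul_assoc]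
    have h2 : U * Uᵀ * (X * Xᵀ) = X * Xᵀ := by
      calc U * Uᵀ * (X * Xᵀ) = U * (Uᵀ * U) * (S * S) * Uᵀ := by
            rw [hSS]; simp only [Matrix.mul_assoc]
        _ = X * Xᵀ := by rw [hU, Matrix.mul_one, hSS]
    rw [h1, h2, sub_self, Matrix.zero_mul]
  refine ⟨Xᵀ * U * T, hU, ?_, hs, ?_⟩
  · calc (Xᵀ * U * T)ᵀ * (Xᵀ * U * T) = T * Uᵀ * (X * Xᵀ) * U * T := by
          simp [Matrix.mul_assoc, hTt]
      _ = T * (Uᵀ * U) * S * S * (Uᵀ * U) * T := by rw [hSS]; simp only [Matrix.mul_assoc]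
      _ = (T * S) * (S * T) := by rw [hU]; simp only [Matrix.mul_one, Matrix.mul_assoc]
      _ = 1 := by rw [hTS, hST, Matrix.mul_one]
  · calc X = U * Uᵀ * X := sub_eq_zero.mp hproj
      _ = U * (S * T) * (Uᵀ * X) := by rw [hST, Matrix.mul_one, Matrix.mul_assoc]
      _ = _ := by simp [Matrix.mul_assoc, hTt, hSdef]

/-- Diagonalize `X Xᵀ` and keep only the eigenvectors with nonzero eigenvalue, which index the
decomposition; the singular values are the square roots of these eigenvalues. -/
theorem exists_isCompactSVD {n m : ℕ} (X : Matrix (Fin n) (Fin m) ℝ) :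
    ∃ (ι : Type) (_ : Fintype ι) (_ : DecidableEq ι) (U : Matrix (Fin n) ι ℝ) (s : ι → ℝ)
      (V : Matrix (Fin m) ι ℝ), IsCompactSVD X U s V := by
  classical
  have hps : (X * Xᵀ).PosSemidef := by
    simpa using Matrix.posSemidef_self_mul_conjTranspose X
  have hH := hps.isHermitian
  obtain ⟨E, e, hEE, hspec, he0⟩ : ∃ (E : Matrix (Fin n) (Fin n) ℝ) (e : Fin n → ℝ),
      Eᵀ * E = 1 ∧ X * Xᵀ = E * Matrix.diagonal e * Eᵀ ∧ ∀ i, 0 ≤ e i := by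
    refine ⟨hH.eigenvectorUnitary.1, hH.eigenvalues, ?_, ?_, hps.eigenvalues_nonneg⟩
    · simpa [Matrix.star_eq_conjTranspose] using
        Unitary.coe_star_mul_self hH.eigenvectorUnitary
    · have := hH.spectral_theorem
      rw [Unitary.conjStarAlgAut_apply] at this
      simpa [Matrix.star_eq_conjTranspose, Function.comp_def] using this
  obtain ⟨U, hUdef⟩ : ∃ U : Matrix (Fin n) {i // e i ≠ 0} ℝ, ∀ a i, U a i = E a i :=
    ⟨E.submatrix id Subtype.val, fun _ _ => rfl⟩
  obtain ⟨s, hsdef⟩ : ∃ s : {i // e i ≠ 0} → ℝ, ∀ i, s i = √(e i) := ⟨fun i => √(e i), fun _ => rfl⟩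
  have hs : ∀ i, 0 < s i := fun i => by
    rw [hsdef]; exact Real.sqrt_pos.mpr ((he0 i).lt_of_ne' i.2)
  have hU : Uᵀ * U = 1 := by
    ext i j
    have := congrFun (congrFun hEE i.1) j.1
    simpa only [Matrix.mul_apply, Matrix.transpose_apply, Matrix.one_apply, hUdef,
      ← Subtype.ext_iff] using this
  have hspec' : X * Xᵀ = U * Matrix.diagonal (fun i => s i * s i) * Uᵀ := by
    rw [hspec]
    ext i j
    rw [Matrix.mul_apply, Matrix.mul_apply]
    simp only [Matrix.mul_diagonal, Matrix.transpose_apply, hUdef, hsdef]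
    rw [← Finset.sum_subtype (p := fun k => e k ≠ 0) (Finset.univ.filter fun k => e k ≠ 0)
      (by simp) (fun k => E i k * (√(e k) * √(e k)) * E j k), Finset.sum_filter]
    refine Finset.sum_congr rfl fun k _ => ?_
    rw [Real.mul_self_sqrt (he0 k)]
    split_ifs with hk
    · rfl
    · simp [not_not.mp hk]
  obtain ⟨V, hV⟩ := exists_isCompactSVD_of_mul_transpose_eq hU hs hspec'
  exact ⟨_, inferInstance, inferInstance, U, s, V, hV⟩

/-! ### Bounds for the nuclear norm and factorization at fixed rank -/

/-- Twice the gap between the mean of the squared Frobenius norms of `B` and `D`, and the pairing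
of `B * Dᵀ` with `U * Vᵀ`. -/
def pairingGap {p q ι κ : Type*} [Fintype p] [Fintype q] [Fintype ι] [Fintype κ]
    (U : Matrix p ι ℝ) (V : Matrix q ι ℝ) (B : Matrix p κ ℝ) (D : Matrix q κ ℝ) : ℝ :=
  ((Uᵀ * B - Vᵀ * D)ᵀ * (Uᵀ * B - Vᵀ * D)).trace
    + ((B - U * (Uᵀ * B))ᵀ * (B - U * (Uᵀ * B))).trace
    + ((D - V * (Vᵀ * D))ᵀ * (D - V * (Vᵀ * D))).trace

section pairing

variable {p q ι κ : Type*} [Fintype p] [Fintype q] [Fintype ι] [Fintype κ]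
  {U : Matrix p ι ℝ} {V : Matrix q ι ℝ}

theorem pairingGap_nonneg (U : Matrix p ι ℝ) (V : Matrix q ι ℝ) (B : Matrix p κ ℝ)
    (D : Matrix q κ ℝ) : 0 ≤ pairingGap U V B D :=
  add_nonneg (add_nonneg (trace_transpose_mul_self_nonneg _) (trace_transpose_mul_self_nonneg _))
    (trace_transpose_mul_self_nonneg _)

theorem trace_sub_projection [DecidableEq ι] (hU : Uᵀ * U = 1) (B : Matrix p κ ℝ) :
    ((B - U * (Uᵀ * B))ᵀ * (B - U * (Uᵀ * B))).trace
      = (Bᵀ * B).trace - ((Uᵀ * B)ᵀ * (Uᵀ * B)).trace := by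
  have h : (B - U * (Uᵀ * B))ᵀ * (B - U * (Uᵀ * B)) = Bᵀ * B - (Uᵀ * B)ᵀ * (Uᵀ * B) := by
    have h1 : Bᵀ * U * (Uᵀ * U) * (Uᵀ * B) = Bᵀ * U * (Uᵀ * B) := by rw [hU, Matrix.mul_one]
    simp only [Matrix.transpose_sub, Matrix.transpose_mul, Matrix.transpose_transpose,
      Matrix.sub_mul, Matrix.mul_sub, Matrix.mul_assoc] at h1 ⊢
    rw [h1]; abel
  rw [h, Matrix.trace_sub]

/-- Pythagoras for the projections `U Uᵀ` and `V Vᵀ`, then polarization of `‖UᵀB - VᵀD‖²`. Being an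
exact identity, it yields both bounds on the nuclear norm and a differentiable expression for the
error. -/
theorem two_mul_trace_pairing [DecidableEq ι] (hU : Uᵀ * U = 1) (hV : Vᵀ * V = 1) (B : Matrix p κ ℝ)
    (D : Matrix q κ ℝ) :
    2 * (V * Uᵀ * (B * Dᵀ)).trace
      = (Bᵀ * B).trace + (Dᵀ * D).trace - pairingGap U V B D := by
  rw [pairingGap, trace_sub_projection hU, trace_sub_projection hV]
  have h1 : ((Vᵀ * D)ᵀ * (Uᵀ * B)).trace = (V * Uᵀ * (B * Dᵀ)).trace := by
    rw [Matrix.transpose_mul, Matrix.transpose_transpose, ← Matrix.mul_assoc (V * Uᵀ),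
      Matrix.trace_mul_comm (V * Uᵀ * B)]
    simp only [Matrix.mul_assoc]
  have h2 : ((Uᵀ * B)ᵀ * (Vᵀ * D)).trace = (V * Uᵀ * (B * Dᵀ)).trace := by
    rw [← h1, ← Matrix.trace_transpose, Matrix.transpose_mul, Matrix.transpose_transpose]
  have h3 : ((Uᵀ * B - Vᵀ * D)ᵀ * (Uᵀ * B - Vᵀ * D)).trace
      = ((Uᵀ * B)ᵀ * (Uᵀ * B)).trace + ((Vᵀ * D)ᵀ * (Vᵀ * D)).trace
        - 2 * (V * Uᵀ * (B * Dᵀ)).trace := by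
    rw [Matrix.transpose_sub, Matrix.sub_mul, Matrix.mul_sub, Matrix.mul_sub, Matrix.trace_sub,
      Matrix.trace_sub, Matrix.trace_sub, h1, h2]
    ring
  rw [h3]; ring

end pairing

/-- The nuclear norm is at most the mean of the squared Frobenius norms of the factors. -/
theorem two_mul_trace_sqrt_le {n m : ℕ} {κ : Type*} [Fintype κ] (B : Matrix (Fin n) κ ℝ)
    (D : Matrix (Fin m) κ ℝ) :
    2 * (CFC.sqrt (B * Dᵀ * (B * Dᵀ)ᵀ)).trace ≤ (Bᵀ * B).trace + (Dᵀ * D).trace := by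
  obtain ⟨ι, _, _, U, s, V, h⟩ := exists_isCompactSVD (B * Dᵀ)
  rw [h.trace_sqrt, ← h.trace_pairing,
    two_mul_trace_pairing h.left_orthonormal h.right_orthonormal]
  linarith [pairingGap_nonneg U V B D]

/-- The nuclear norm dominates the pairing with a partial isometry. -/
theorem trace_pairing_le_trace_sqrt {n m : ℕ} {ι : Type*} [Fintype ι] [DecidableEq ι]
    {U : Matrix (Fin n) ι ℝ} {V : Matrix (Fin m) ι ℝ} (hU : Uᵀ * U = 1) (hV : Vᵀ * V = 1)
    (X : Matrix (Fin n) (Fin m) ℝ) : (V * Uᵀ * X).trace ≤ (CFC.sqrt (X * Xᵀ)).trace := by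
  obtain ⟨κ, _, _, U', s, V', h⟩ := exists_isCompactSVD X
  set R : Matrix κ κ ℝ := Matrix.diagonal fun i => √(s i) with hR
  have hRR : R * R = Matrix.diagonal s := by
    rw [hR, Matrix.diagonal_mul_diagonal]
    simp only [Real.mul_self_sqrt (h.pos _).le]
  have hRt : Rᵀ = R := Matrix.diagonal_transpose _
  -- The balanced factorization: both factors have squared Frobenius norm `∑ s`, so nonnegativity of
  -- the gap is exactly the claim.
  have hX : X = (U' * R) * (V' * R)ᵀ := by
    rw [h.eq, Matrix.transpose_mul, hRt, ← hRR]; simp only [Matrix.mul_assoc]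
  have hfro : ∀ {l : ℕ} {M : Matrix (Fin l) κ ℝ}, Mᵀ * M = 1 →
      ((M * R)ᵀ * (M * R)).trace = ∑ i, s i := by
    intro l M hM
    rw [Matrix.transpose_mul, hRt, Matrix.mul_assoc, ← Matrix.mul_assoc Mᵀ, hM, Matrix.one_mul,
      hRR, Matrix.trace_diagonal]
  have h2 := two_mul_trace_pairing hU hV (U' * R) (V' * R)
  rw [← hX, hfro h.left_orthonormal, hfro h.right_orthonormal] at h2
  rw [h.trace_sqrt]
  linarith [pairingGap_nonneg U V (U' * R) (V' * R)]

/-- A matrix of rank `card ι` with an invertible `ι × ι` compression factors through it. -/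
theorem eq_mul_inv_compress_mul {p q ι : Type*} [Fintype p] [Fintype q] [Fintype ι]
    [DecidableEq q] [DecidableEq ι] {X : Matrix p q ℝ} {U : Matrix p ι ℝ} {V : Matrix q ι ℝ}
    (hX : X.rank = Fintype.card ι) (hN : IsUnit (Uᵀ * X * V)) :
    X = X * V * ((Uᵀ * X * V)⁻¹ * (Uᵀ * X)) := by
  have hle : LinearMap.range (X * V).mulVecLin ≤ LinearMap.range X.mulVecLin := by
    rw [Matrix.mulVecLin_mul]; exact LinearMap.range_comp_le_range _ _
  have hrk : X.rank ≤ (X * V).rank := by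
    rw [hX, ← Matrix.rank_of_isUnit _ hN, Matrix.mul_assoc]
    exact Matrix.rank_mul_le_right _ _
  -- The invertible compression forces `X * V` to have full rank `card ι`, so its column space is
  -- all of that of `X`.
  have hrange : LinearMap.range (X * V).mulVecLin = LinearMap.range X.mulVecLin :=
    Submodule.eq_of_le_of_finrank_le hle hrk
  have hcol : ∀ j, ∃ z, (X * V) *ᵥ z = X.col j := by
    intro j
    have : X.col j ∈ LinearMap.range (X * V).mulVecLin := by
      rw [hrange]; exact ⟨Pi.single j 1, by simp⟩
    exact this
  choose z hz using hcol
  have hXZ : X = X * V * (Matrix.of z)ᵀ := by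
    ext i j
    exact (congrFun (hz j) i).symm
  have hdet : IsUnit (Uᵀ * X * V).det := (Matrix.isUnit_iff_isUnit_det _).mp hN
  have hZ : (Uᵀ * X * V)⁻¹ * (Uᵀ * X) = (Matrix.of z)ᵀ := by
    have : Uᵀ * X = Uᵀ * X * V * (Matrix.of z)ᵀ := by
      conv_lhs => rw [hXZ]
      simp only [Matrix.mul_assoc]
    calc (Uᵀ * X * V)⁻¹ * (Uᵀ * X) = (Uᵀ * X * V)⁻¹ * (Uᵀ * X * V * (Matrix.of z)ᵀ) :=
          congrArg _ this
      _ = _ := by rw [← Matrix.mul_assoc, Matrix.nonsing_inv_mul _ hdet, Matrix.one_mul]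
  rw [hZ]; exact hXZ

/-! ### Differentiability of matrix expressions -/

section calculus

attribute [local instance] Matrix.normedAddCommGroup Matrix.normedSpace

variable {E : Type*} [NormedAddCommGroup E] [NormedSpace ℝ E] {x : E}
  {p q r : Type*} [Fintype p] [Fintype q] [Fintype r]

theorem differentiableAt_matrix {p : Type*} [Finite p] {F : E → Matrix p q ℝ} :
    DifferentiableAt ℝ F x ↔ ∀ i j, DifferentiableAt ℝ (fun y => F y i j) x :=
  differentiableAt_pi.trans (forall_congr' fun _ => differentiableAt_pi)

theorem differentiableAt_matrix_mul {F : E → Matrix p q ℝ} {G : E → Matrix q r ℝ}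
    (hF : DifferentiableAt ℝ F x) (hG : DifferentiableAt ℝ G x) :
    DifferentiableAt ℝ (fun y => F y * G y) x := by
  rw [differentiableAt_matrix] at *
  intro i j
  simp only [Matrix.mul_apply]
  exact DifferentiableAt.fun_sum fun k _ => (hF i k).mul (hG k j)

theorem differentiableAt_matrix_transpose {F : E → Matrix p q ℝ} (hF : DifferentiableAt ℝ F x) :
    DifferentiableAt ℝ (fun y => (F y)ᵀ) x := by
  rw [differentiableAt_matrix] at *
  exact fun i j => hF j i

theorem differentiableAt_matrix_trace {F : E → Matrix p p ℝ} (hF : DifferentiableAt ℝ F x) :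
    DifferentiableAt ℝ (fun y => (F y).trace) x := by
  rw [differentiableAt_matrix] at hF
  simp only [Matrix.trace, Matrix.diag_apply]
  exact DifferentiableAt.fun_sum fun k _ => hF k k

theorem differentiableAt_matrix_det [DecidableEq p] {F : E → Matrix p p ℝ}
    (hF : DifferentiableAt ℝ F x) : DifferentiableAt ℝ (fun y => (F y).det) x := by
  rw [differentiableAt_matrix] at hF
  simp only [Matrix.det_apply']
  exact DifferentiableAt.fun_sum fun σ _ =>
    (DifferentiableAt.const_mul (HasFDerivAt.finsetProd fun i _ =>
      (hF (σ i) i).hasFDerivAt).differentiableAt _)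

/-- Cramer's rule: the entries of the adjugate are again determinants. -/
theorem differentiableAt_matrix_inv [DecidableEq p] {F : E → Matrix p p ℝ}
    (hF : DifferentiableAt ℝ F x) (hx : (F x).det ≠ 0) :
    DifferentiableAt ℝ (fun y => (F y)⁻¹) x := by
  rw [differentiableAt_matrix]
  intro i j
  simp only [Matrix.inv_def, Matrix.smul_apply, Ring.inverse_eq_inv', smul_eq_mul,
    Matrix.adjugate_apply]
  refine ((differentiableAt_matrix_det hF).fun_inv hx).mul (differentiableAt_matrix_det ?_)
  rw [differentiableAt_matrix] at hF ⊢
  intro a b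
  simp only [Matrix.updateRow_apply]
  split_ifs
  · exact differentiableAt_const _
  · exact hF a b

theorem differentiableAt_trace_transpose_mul_self {F : E → Matrix p q ℝ}
    (hF : DifferentiableAt ℝ F x) : DifferentiableAt ℝ (fun y => ((F y)ᵀ * F y).trace) x :=
  differentiableAt_matrix_trace
    (differentiableAt_matrix_mul (differentiableAt_matrix_transpose hF) hF)

theorem differentiableAt_pairingGap {ι : Type*} [Fintype ι] {U : Matrix p ι ℝ}
    {V : Matrix q ι ℝ} {B : E → Matrix p r ℝ} {D : E → Matrix q r ℝ}
    (hB : DifferentiableAt ℝ B x) (hD : DifferentiableAt ℝ D x) :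
    DifferentiableAt ℝ (fun y => pairingGap U V (B y) (D y)) x := by
  have hUB : DifferentiableAt ℝ (fun y => Uᵀ * B y) x :=
    differentiableAt_matrix_mul (differentiableAt_const _) hB
  have hVD : DifferentiableAt ℝ (fun y => Vᵀ * D y) x :=
    differentiableAt_matrix_mul (differentiableAt_const _) hD
  exact ((differentiableAt_trace_transpose_mul_self (hUB.sub hVD)).add
    (differentiableAt_trace_transpose_mul_self
      (hB.sub (differentiableAt_matrix_mul (differentiableAt_const _) hUB)))).add
    (differentiableAt_trace_transpose_mul_self
      (hD.sub (differentiableAt_matrix_mul (differentiableAt_const _) hVD)))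

/-- A function bounded on `s` near `x` by a nonnegative differentiable function that vanishes at
`x` has derivative zero within `s`. -/
theorem hasFDerivWithinAt_zero_of_abs_le {f G : E → ℝ} {s : Set E} (hG : DifferentiableAt ℝ G x)
    (hG0 : ∀ y, 0 ≤ G y) (hGx : G x = 0) (hxs : x ∈ s)
    (h : ∀ᶠ y in nhdsWithin x s, |f y| ≤ G y) :
    HasFDerivWithinAt f (0 : E →L[ℝ] ℝ) s x := by
  -- Fermat: `G` attains its minimum at `x`, so its derivative there is zero and `G` itself is
  -- little-o.
  have hmin : IsLocalMin G x := Filter.Eventually.of_forall fun y => by rw [hGx]; exact hG0 y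
  have hd : HasFDerivAt G (0 : E →L[ℝ] ℝ) x := by
    have := hG.hasFDerivAt
    rwa [hmin.fderiv_eq_zero] at this
  have hfx : f x = 0 := by
    have := h.self_of_nhdsWithin hxs
    rw [hGx] at this
    exact abs_nonpos_iff.mp this
  have ho := (hd.hasFDerivWithinAt (s := s)).isLittleO
  refine HasFDerivWithinAt.of_isLittleO (Asymptotics.IsBigO.trans_isLittleO ?_ ho)
  refine Asymptotics.IsBigO.of_bound 1 (h.mono fun y hy => ?_)
  simpa [hfx, hGx, abs_of_nonneg (hG0 y)] using hy

end calculus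

/-! ### The derivative of the loss at fixed rank -/

/-- The functional `H ↦ tr(Gᵀ H)`. -/
noncomputable def frobeniusDual {n m : ℕ} (G : Matrix (Fin n) (Fin m) ℝ) :
    Matrix (Fin n) (Fin m) ℝ →L[ℝ] ℝ :=
  LinearMap.toContinuousLinearMap
    { toFun := fun H => (Gᵀ * H).trace
      map_add' := fun H K => by rw [Matrix.mul_add, Matrix.trace_add]
      map_smul' := fun c H => by rw [Matrix.mul_smul, Matrix.trace_smul]; rfl }

@[simp]
theorem frobeniusDual_apply {n m : ℕ} (G H : Matrix (Fin n) (Fin m) ℝ) :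
    frobeniusDual G H = (Gᵀ * H).trace := rfl

/-- The curve `t ↦ (1 + tP) W` keeps the rank while `1 + tP` is invertible. These are not all
tangent directions, but they suffice for the critical point equation. -/
theorem mul_mem_tangentConeAt_rankEq {n m k : ℕ} {W : Matrix (Fin n) (Fin m) ℝ}
    (hW : W ∈ rankEq k n m) (P : Matrix (Fin n) (Fin n) ℝ) :
    P * W ∈ tangentConeAt ℝ (rankEq k n m) W := by
  let _ := Matrix.normedAddCommGroup (m := Fin n) (n := Fin m) (α := ℝ)
  let _ := Matrix.normedSpace (R := ℝ) (m := Fin n) (n := Fin m) (α := ℝ)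
  set T : Set ℝ := {t | (1 + t • P).det ≠ 0} with hT
  have hTn : T ∈ nhds (0 : ℝ) := by
    have hc : Continuous fun t : ℝ => (1 + t • P).det := by fun_prop
    exact (isOpen_ne.preimage hc).mem_nhds (by simp)
  have hγ : HasFDerivWithinAt (fun t : ℝ => W + t • (P * W))
      ((ContinuousLinearMap.id ℝ ℝ).smulRight (P * W)) T 0 :=
    ((ContinuousLinearMap.id ℝ ℝ).smulRight (P * W)).hasFDerivWithinAt.const_add W
  have h1 : (1 : ℝ) ∈ tangentConeAt ℝ T 0 := by
    rw [tangentConeAt_of_mem_nhds hTn]; trivial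
  have h2 := hγ.mapsTo_tangent_cone h1
  have hsub : (fun t : ℝ => W + t • (P * W)) '' T ⊆ rankEq k n m := by
    rintro _ ⟨t, ht, rfl⟩
    have : W + t • (P * W) = (1 + t • P) * W := by simp [Matrix.add_mul]
    change (W + t • (P * W)).rank = k
    rw [this, Matrix.rank_mul_eq_right_of_isUnit_det _ _ (isUnit_iff_ne_zero.mpr ht)]
    exact hW
  have h3 := tangentConeAt_mono hsub h2
  have h4 : (1 : ℝ) • (P * W) ∈ tangentConeAt ℝ (rankEq k n m) (W + (0 : ℝ) • (P * W)) := h3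
  simpa using h4

theorem lossOne_eq {n m : ℕ} {S₀ A : Matrix (Fin n) (Fin n) ℝ} (hA : CFC.sqrt S₀ = A)
    (hAt : Aᵀ = A) (W : Matrix (Fin n) (Fin m) ℝ) :
    lossOne S₀ W = (Wᵀ * W).trace + S₀.trace
      - 2 * (CFC.sqrt (A * W * (A * W)ᵀ)).trace := by
  rw [lossOne, buresSq, hA, Matrix.trace_sub, Matrix.trace_add, Matrix.trace_smul, smul_eq_mul,
    Matrix.trace_mul_comm W, Matrix.transpose_mul, hAt]
  simp only [Matrix.mul_assoc]

theorem hasFDerivWithinAt_lossOne {n m : ℕ} {ι : Type*} [Fintype ι] [DecidableEq ι]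
    {S₀ A : Matrix (Fin n) (Fin n) ℝ} (hA : CFC.sqrt S₀ = A) (hAt : Aᵀ = A)
    (hdet : IsUnit A.det) {W : Matrix (Fin n) (Fin m) ℝ} {U : Matrix (Fin n) ι ℝ} {s : ι → ℝ}
    {V : Matrix (Fin m) ι ℝ} (h : IsCompactSVD (A * W) U s V) :
    HasFDerivWithinAt (lossOne S₀) (frobeniusDual ((2 : ℝ) • (W - A * U * Vᵀ)))
      (rankEq (Fintype.card ι) n m) W := by
  let _ := Matrix.normedAddCommGroup (m := Fin n) (n := Fin m) (α := ℝ)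
  let _ := Matrix.normedSpace (R := ℝ) (m := Fin n) (n := Fin m) (α := ℝ)
  set R : Matrix ι ι ℝ := Matrix.diagonal fun i => √(s i) with hR
  set T : Matrix ι ι ℝ := Matrix.diagonal fun i => (√(s i))⁻¹ with hT
  have hTR : T * R = 1 := by
    rw [hT, hR, Matrix.diagonal_mul_diagonal, ← Matrix.diagonal_one]
    congr 1; funext i; exact inv_mul_cancel₀ (Real.sqrt_pos.mpr (h.pos i)).ne'
  have hRT : R * T = 1 := mul_eq_one_comm.mp hTR
  have hRR : R * R = Matrix.diagonal s := by
    rw [hR, Matrix.diagonal_mul_diagonal]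
    simp only [Real.mul_self_sqrt (h.pos _).le]
  have hRt : Rᵀ = R := Matrix.diagonal_transpose _
  let N : Matrix (Fin n) (Fin m) ℝ → Matrix ι ι ℝ := fun Y => Uᵀ * (A * Y) * V
  -- The factorization `A Y = (A Y V) (N Y)⁻¹ (Uᵀ A Y)`, balanced by inserting `T * R = 1` so that
  -- at `W` the factors are `U R` and `V R`, where the pairing gap vanishes.
  let B : Matrix (Fin n) (Fin m) ℝ → Matrix (Fin n) ι ℝ := fun Y => A * Y * V * T
  let D : Matrix (Fin n) (Fin m) ℝ → Matrix (Fin m) ι ℝ := fun Y =>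
    (R * ((N Y)⁻¹ * (Uᵀ * (A * Y))))ᵀ
  let q : Matrix (Fin n) (Fin m) ℝ → ℝ := fun Y => ((Y - W)ᵀ * (Y - W)).trace
  let G : Matrix (Fin n) (Fin m) ℝ → ℝ := fun Y => q Y + pairingGap U V (B Y) (D Y)
  have hNW : N W = Matrix.diagonal s := h.compress_eq
  have hNdet : (N W).det ≠ 0 := by
    rw [hNW, Matrix.det_diagonal]
    exact Finset.prod_ne_zero_iff.mpr fun i _ => (h.pos i).ne'
  have dA : DifferentiableAt ℝ (fun Y : Matrix (Fin n) (Fin m) ℝ => A * Y) W :=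
    differentiableAt_matrix_mul (differentiableAt_const _) differentiableAt_id
  have dN : DifferentiableAt ℝ N W :=
    differentiableAt_matrix_mul (differentiableAt_matrix_mul (differentiableAt_const _) dA)
      (differentiableAt_const _)
  have dB : DifferentiableAt ℝ B W :=
    differentiableAt_matrix_mul (differentiableAt_matrix_mul dA (differentiableAt_const _))
      (differentiableAt_const _)
  have dD : DifferentiableAt ℝ D W :=
    differentiableAt_matrix_transpose (differentiableAt_matrix_mul (differentiableAt_const _)
      (differentiableAt_matrix_mul (differentiableAt_matrix_inv dN hNdet)
        (differentiableAt_matrix_mul (differentiableAt_const _) dA)))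
  have dG : DifferentiableAt ℝ G W :=
    (differentiableAt_trace_transpose_mul_self (differentiableAt_id.sub_const W)).add
      (differentiableAt_pairingGap dB dD)
  have hG0 : ∀ Y, 0 ≤ G Y := fun Y =>
    add_nonneg (trace_transpose_mul_self_nonneg _) (pairingGap_nonneg _ _ _ _)
  have hBW : B W = U * R := by
    calc B W = U * Matrix.diagonal s * (Vᵀ * V) * T := by
          simp only [B]; rw [h.eq]; simp only [Matrix.mul_assoc]
      _ = U * R * (R * T) := by
          rw [h.right_orthonormal, ← hRR]; simp only [Matrix.mul_one, Matrix.mul_assoc]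
      _ = U * R := by rw [hRT, Matrix.mul_one]
  have hDW : D W = V * R := by
    have hdetS : IsUnit (Matrix.diagonal s).det := by
      rw [← hNW]; exact isUnit_iff_ne_zero.mpr hNdet
    have : (N W)⁻¹ * (Uᵀ * (A * W)) = Vᵀ := by
      calc (N W)⁻¹ * (Uᵀ * (A * W))
          = (Matrix.diagonal s)⁻¹ * ((Uᵀ * U) * Matrix.diagonal s * Vᵀ) := by
            rw [hNW, h.eq]; simp only [Matrix.mul_assoc]
        _ = Vᵀ := by
            rw [h.left_orthonormal, Matrix.one_mul, ← Matrix.mul_assoc,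
              Matrix.nonsing_inv_mul _ hdetS, Matrix.one_mul]
    simp only [D]
    rw [this, Matrix.transpose_mul, hRt, Matrix.transpose_transpose]
  have hGW : G W = 0 := by
    have h1 : Uᵀ * (U * R) = R := by
      rw [← Matrix.mul_assoc, h.left_orthonormal, Matrix.one_mul]
    have h2 : Vᵀ * (V * R) = R := by
      rw [← Matrix.mul_assoc, h.right_orthonormal, Matrix.one_mul]
    simp [G, q, pairingGap, hBW, hDW, h1, h2]
  have hWmem : W ∈ rankEq (Fintype.card ι) n m := by
    change W.rank = _
    rw [← h.rank_eq, Matrix.rank_mul_eq_right_of_isUnit_det _ _ hdet]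
  -- What is left of the loss after its affine approximation at `W`: a square, minus twice the
  -- excess of the nuclear norm over the pairing.
  let rem : Matrix (Fin n) (Fin m) ℝ → ℝ := fun Y => q Y
    - 2 * ((CFC.sqrt (A * Y * (A * Y)ᵀ)).trace - (V * Uᵀ * (A * Y)).trace)
  have hNnear : ∀ᶠ Y in nhds W, (N Y).det ≠ 0 :=
    (differentiableAt_matrix_det dN).continuousAt.eventually_ne hNdet
  -- Twice the excess lies between zero and the pairing gap. The rank condition enters only through
  -- the factorization that gives the upper bound.
  have hrem : ∀ᶠ Y in nhdsWithin W (rankEq (Fintype.card ι) n m), |rem Y| ≤ G Y := by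
    filter_upwards [self_mem_nhdsWithin, nhdsWithin_le_nhds hNnear] with Y hY hN
    have hlow := trace_pairing_le_trace_sqrt h.left_orthonormal h.right_orthonormal (A * Y)
    have hrank : (A * Y).rank = Fintype.card ι := by
      rw [Matrix.rank_mul_eq_right_of_isUnit_det _ _ hdet]; exact hY
    have hfac : A * Y = B Y * (D Y)ᵀ := by
      have h1 := eq_mul_inv_compress_mul (U := U) (V := V) hrank
        ((Matrix.isUnit_iff_isUnit_det _).mpr (isUnit_iff_ne_zero.mpr hN))
      calc A * Y = A * Y * V * ((T * R) * ((N Y)⁻¹ * (Uᵀ * (A * Y)))) := by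
            rw [hTR, Matrix.one_mul]; exact h1
        _ = _ := by simp only [B, D, Matrix.transpose_transpose, Matrix.mul_assoc]
    have hup := two_mul_trace_sqrt_le (B Y) (D Y)
    have hpair := two_mul_trace_pairing h.left_orthonormal h.right_orthonormal (B Y) (D Y)
    rw [← hfac] at hup hpair
    have hq : 0 ≤ q Y := trace_transpose_mul_self_nonneg _
    have hgap := pairingGap_nonneg U V (B Y) (D Y)
    rw [abs_le]
    simp only [rem, G]
    constructor <;> linarith
  have hremd := hasFDerivWithinAt_zero_of_abs_le dG hG0 hGW hWmem hrem
  have hfun : lossOne S₀ = fun Y => frobeniusDual ((2 : ℝ) • (W - A * U * Vᵀ)) Y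
      + rem Y + (S₀.trace - (Wᵀ * W).trace) := by
    funext Y
    rw [lossOne_eq hA hAt]
    have h1 : q Y = (Yᵀ * Y).trace - 2 * (Wᵀ * Y).trace + (Wᵀ * W).trace := by
      have : (Yᵀ * W).trace = (Wᵀ * Y).trace := by
        rw [← Matrix.trace_transpose, Matrix.transpose_mul, Matrix.transpose_transpose]
      simp only [q, Matrix.transpose_sub, Matrix.sub_mul, Matrix.mul_sub, Matrix.trace_sub, this]
      ring
    have h2 : frobeniusDual ((2 : ℝ) • (W - A * U * Vᵀ)) Y
        = 2 * (Wᵀ * Y).trace - 2 * (V * Uᵀ * (A * Y)).trace := by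
      simp [Matrix.sub_mul, hAt, Matrix.mul_assoc, mul_sub]
    rw [h2]
    simp only [rem, h1]
    ring
  rw [hfun]
  have := (((frobeniusDual ((2 : ℝ) • (W - A * U * Vᵀ))).hasFDerivWithinAt
    (x := W) (s := rankEq (Fintype.card ι) n m)).add hremd).add_const (S₀.trace - (Wᵀ * W).trace)
  refine this.congr_fderiv ?_
  ext H
  exact add_zero _

/-! ### Diagonals of projections and a linear program -/

section projection

variable {p : Type*} [Fintype p]

theorem diag_eq_sum_sq {M : Matrix p p ℝ} (hMt : Mᵀ = M) (hM : M * M = M) (i : p) :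
    M i i = ∑ j, M i j ^ 2 := by
  conv_lhs => rw [← hM, Matrix.mul_apply]
  refine Finset.sum_congr rfl fun j _ => ?_
  have h : M j i = M i j := congrFun (congrFun hMt i) j
  rw [h, sq]

theorem sq_diag_le_diag {M : Matrix p p ℝ} (hMt : Mᵀ = M) (hM : M * M = M) (i : p) :
    M i i ^ 2 ≤ M i i := by
  conv_rhs => rw [diag_eq_sum_sq hMt hM i]
  exact Finset.single_le_sum (f := fun j => M i j ^ 2) (fun j _ => sq_nonneg _)
    (Finset.mem_univ i)

theorem diag_nonneg_of_projection {M : Matrix p p ℝ} (hMt : Mᵀ = M) (hM : M * M = M) (i : p) :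
    0 ≤ M i i :=
  (sq_nonneg _).trans (sq_diag_le_diag hMt hM i)

theorem diag_le_one_of_projection {M : Matrix p p ℝ} (hMt : Mᵀ = M) (hM : M * M = M) (i : p) :
    M i i ≤ 1 := by
  nlinarith [sq_diag_le_diag hMt hM i]

/-- An orthogonal projection whose diagonal is a `0`-`1` vector is diagonal. -/
theorem eq_diagonal_of_projection [DecidableEq p] {M : Matrix p p ℝ} (hMt : Mᵀ = M)
    (hM : M * M = M) (h : ∀ i, M i i ^ 2 = M i i) : M = Matrix.diagonal fun i => M i i := by
  ext i j
  rcases eq_or_ne i j with rfl | hij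
  · simp
  · rw [Matrix.diagonal_apply_ne _ hij]
    have h1 := diag_eq_sum_sq hMt hM i
    -- Since `M i i = ∑ j, M i j ^ 2` and the diagonal term already accounts for all of it, the
    -- off-diagonal squares sum to zero.
    rw [← Finset.add_sum_erase _ _ (Finset.mem_univ i), h i, left_eq_add,
      Finset.sum_eq_zero_iff_of_nonneg fun _ _ => sq_nonneg _] at h1
    exact pow_eq_zero_iff (two_ne_zero) |>.mp (h1 j (by simp [hij.symm]))

end projection

/-- A dual multiplier for the constraint on the sum: the midpoint of the last kept and first dropped
weights, or half of the last weight when `k = n`. -/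
theorem exists_threshold {n k : ℕ} (hk : 1 ≤ k) (hkn : k ≤ n) {lam : Fin n → ℝ}
    (hlam : StrictAnti lam) (hpos : ∀ i, 0 < lam i) :
    ∃ c, 0 < c ∧ (∀ i : Fin n, i.val < k → c < lam i) ∧ ∀ i : Fin n, k ≤ i.val → lam i < c := by
  have hlast : k - 1 < n := by omega
  have hle : ∀ i : Fin n, i.val < k → lam ⟨k - 1, hlast⟩ ≤ lam i := fun i hi =>
    hlam.antitone (Fin.le_def.mpr (by simp; omega))
  rcases hkn.lt_or_eq with h | h
  · have h1 : lam ⟨k, h⟩ < lam ⟨k - 1, hlast⟩ := hlam (Fin.lt_def.mpr (by simp; omega))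
    refine ⟨(lam ⟨k, h⟩ + lam ⟨k - 1, hlast⟩) / 2, ?_, fun i hi => ?_, fun i hi => ?_⟩
    · linarith [hpos ⟨k, h⟩]
    · linarith [hle i hi]
    · have : lam i ≤ lam ⟨k, h⟩ := hlam.antitone (Fin.le_def.mpr hi)
      linarith
  · refine ⟨lam ⟨k - 1, hlast⟩ / 2, half_pos (hpos _), fun i hi => ?_, fun i hi => ?_⟩
    · linarith [hle i hi, hpos ⟨k - 1, hlast⟩]
    · omega

/-- Maximum of a linear functional with decreasing positive weights over the vectors in
`[0, 1]ⁿ` with sum at most `k`, and its unique maximizer. -/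
theorem sum_mul_le_sum_firstIndices {n k : ℕ} (hk : 1 ≤ k) (hkn : k ≤ n) {lam : Fin n → ℝ}
    (hlam : StrictAnti lam) (hpos : ∀ i, 0 < lam i) {p : Fin n → ℝ} (hp0 : ∀ i, 0 ≤ p i)
    (hp1 : ∀ i, p i ≤ 1) (hpk : ∑ i, p i ≤ k) :
    ∑ i, lam i * p i ≤ ∑ i ∈ firstIndices n k, lam i ∧
      (∑ i, lam i * p i = ∑ i ∈ firstIndices n k, lam i →
        ∀ i, p i = if i ∈ firstIndices n k then 1 else 0) := by
  obtain ⟨c, hc, hlt, hge⟩ := exists_threshold hk hkn hlam hpos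
  set χ : Fin n → ℝ := fun i => if i ∈ firstIndices n k then 1 else 0 with hχ
  have hmem : ∀ i, i ∈ firstIndices n k ↔ i.val < k := fun i => by simp [firstIndices]
  have hsum : ∑ i ∈ firstIndices n k, lam i = ∑ i, lam i * χ i := by
    simp [hχ]
  have hcard : ∑ i, χ i = k := by
    simp [hχ, card_firstIndices hkn]
  have hterm : ∀ i, 0 ≤ (lam i - c) * (χ i - p i) := by
    intro i
    by_cases hi : i.val < k
    · simp only [hχ, hmem, hi, if_true]
      exact mul_nonneg (sub_nonneg.mpr (hlt i hi).le) (sub_nonneg.mpr (hp1 i))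
    · simp only [hχ, hmem, hi, if_false]
      nlinarith [hge i (not_lt.mp hi), hp0 i]
  -- The duality gap splits into complementary slackness terms and the slack in the sum constraint,
  -- all nonnegative. Because `c` differs from every weight, equality forces `p = χ`.
  have hid : ∑ i, lam i * χ i - ∑ i, lam i * p i
      = ∑ i, (lam i - c) * (χ i - p i) + c * (k - ∑ i, p i) := by
    rw [← hcard, ← Finset.sum_sub_distrib, ← Finset.sum_sub_distrib, Finset.mul_sum,
      ← Finset.sum_add_distrib]
    exact Finset.sum_congr rfl fun i _ => by ring
  have h1 : 0 ≤ ∑ i, (lam i - c) * (χ i - p i) := Finset.sum_nonneg fun i _ => hterm i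
  have h2 : 0 ≤ c * (k - ∑ i, p i) := mul_nonneg hc.le (sub_nonneg.mpr hpk)
  rw [hsum]
  refine ⟨by linarith, fun heq i => ?_⟩
  have h3 : ∑ i, (lam i - c) * (χ i - p i) = 0 := by linarith
  rw [Finset.sum_eq_zero_iff_of_nonneg fun i _ => hterm i] at h3
  have h4 : lam i - c ≠ 0 := by
    by_cases hi : i.val < k
    · exact (sub_pos.mpr (hlt i hi)).ne'
    · exact (sub_neg.mpr (hge i (not_lt.mp hi))).ne
  have := (mul_eq_zero.mp (h3 i (Finset.mem_univ i))).resolve_left h4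
  linarith

/-! ### The candidates and the loss in the spectral basis -/

section spectral

variable {n m k : ℕ} {Ω : Matrix (Fin n) (Fin n) ℝ} {lam : Fin n → ℝ}

theorem columns_transpose_mul_columns (hΩ : Ωᵀ * Ω = 1) (J : Finset (Fin n)) (hJ : J.card = k) :
    (columns Ω J hJ)ᵀ * columns Ω J hJ = 1 := by
  ext i j
  have := congrFun (congrFun hΩ (J.orderEmbOfFin hJ i)) (J.orderEmbOfFin hJ j)
  simpa [Matrix.mul_apply, Matrix.one_apply, columns] using this

theorem columns_conj_diagonal (J : Finset (Fin n)) (hJ : J.card = k) (f : Fin n → ℝ) :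
    columns Ω J hJ * Matrix.diagonal (fun i => f (J.orderEmbOfFin hJ i)) * (columns Ω J hJ)ᵀ
      = Ω * Matrix.diagonal (fun i => if i ∈ J then f i else 0) * Ωᵀ := by
  ext a b
  rw [Matrix.mul_apply, Matrix.mul_apply]
  simp only [Matrix.mul_diagonal, Matrix.transpose_apply, columns, Matrix.submatrix_apply, id]
  have h1 : ∑ i, Ω a i * (if i ∈ J then f i else 0) * Ω b i = ∑ i ∈ J, Ω a i * f i * Ω b i := by
    simp [Finset.sum_ite_mem, ite_mul, mul_ite]
  rw [h1, ← Finset.sum_image (s := Finset.univ) (g := J.orderEmbOfFin hJ)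
    (f := fun i => Ω a i * f i * Ω b i) fun i _ j _ h => (J.orderEmbOfFin hJ).injective h]
  rw [Finset.image_orderEmbOfFin_univ]

theorem candidate_eq (hpos : ∀ i, 0 < lam i) (J : Finset (Fin n)) (hJ : J.card = k)
    (V : Matrix (Fin m) (Fin k) ℝ) :
    candidate Ω (Matrix.diagonal lam) J hJ V
      = columns Ω J hJ * Matrix.diagonal (fun i => √(lam (J.orderEmbOfFin hJ i))) * Vᵀ := by
  have : principal (Matrix.diagonal lam) J hJ
      = Matrix.diagonal fun i => lam (J.orderEmbOfFin hJ i) :=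
    Matrix.submatrix_diagonal _ _ (J.orderEmbOfFin hJ).injective
  rw [candidate, this, sqrt_diagonal fun i => (hpos _).le]

theorem isCompactSVD_candidate (hΩ : Ωᵀ * Ω = 1) (hpos : ∀ i, 0 < lam i) (J : Finset (Fin n))
    (hJ : J.card = k) {V : Matrix (Fin m) (Fin k) ℝ} (hV : Vᵀ * V = 1) :
    IsCompactSVD (candidate Ω (Matrix.diagonal lam) J hJ V) (columns Ω J hJ)
      (fun i => √(lam (J.orderEmbOfFin hJ i))) V :=
  ⟨columns_transpose_mul_columns hΩ J hJ, hV, fun _ => Real.sqrt_pos.mpr (hpos _),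
    candidate_eq hpos J hJ V⟩

theorem exists_eq_candidate_of_mul_transpose_eq (hΩ : Ωᵀ * Ω = 1) (hpos : ∀ i, 0 < lam i)
    (J : Finset (Fin n)) (hJ : J.card = k) {W : Matrix (Fin n) (Fin m) ℝ}
    (hW : W * Wᵀ = Ω * Matrix.diagonal (fun i => if i ∈ J then lam i else 0) * Ωᵀ) :
    ∃ V : Matrix (Fin m) (Fin k) ℝ, Vᵀ * V = 1 ∧ W = candidate Ω (Matrix.diagonal lam) J hJ V := by
  rw [← columns_conj_diagonal J hJ] at hW
  obtain ⟨V, hV⟩ := exists_isCompactSVD_of_mul_transpose_eq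
    (columns_transpose_mul_columns hΩ J hJ)
    (s := fun i => √(lam (J.orderEmbOfFin hJ i))) (fun i => Real.sqrt_pos.mpr (hpos _))
    (by simpa only [Real.mul_self_sqrt (hpos _).le] using hW)
  exact ⟨V, hV.right_orthonormal, hV.eq.trans (candidate_eq hpos J hJ V).symm⟩

/-- The square root `Ω diag(√λ) Ωᵀ` of `Ω diag(λ) Ωᵀ`. -/
noncomputable def rootConj (Ω : Matrix (Fin n) (Fin n) ℝ) (lam : Fin n → ℝ) :
    Matrix (Fin n) (Fin n) ℝ :=
  Ω * Matrix.diagonal (fun i => √(lam i)) * Ωᵀ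

theorem transpose_rootConj : (rootConj Ω lam)ᵀ = rootConj Ω lam := by
  simp [rootConj, Matrix.mul_assoc]

theorem rootConj_mul_self (hΩ : Ωᵀ * Ω = 1) (hpos : ∀ i, 0 < lam i) :
    rootConj Ω lam * rootConj Ω lam = Ω * Matrix.diagonal lam * Ωᵀ := by
  rw [rootConj, conj_diagonal_mul_conj_diagonal hΩ]
  simp only [Real.mul_self_sqrt (hpos _).le]

theorem sqrt_eq_rootConj (hΩ : Ωᵀ * Ω = 1) (hpos : ∀ i, 0 < lam i) :
    CFC.sqrt (Ω * Matrix.diagonal lam * Ωᵀ) = rootConj Ω lam :=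
  sqrt_conj_diagonal hΩ fun i => (hpos i).le

theorem isUnit_det_rootConj (hΩ : Ωᵀ * Ω = 1) (hpos : ∀ i, 0 < lam i) :
    IsUnit (rootConj Ω lam).det := by
  have h : Ω.det * Ω.det = 1 := by
    simpa using congrArg Matrix.det hΩ
  rw [rootConj, Matrix.det_mul, Matrix.det_mul, Matrix.det_transpose, Matrix.det_diagonal,
    isUnit_iff_ne_zero]
  have hΩ0 : Ω.det ≠ 0 := left_ne_zero_of_mul_eq_one h
  exact mul_ne_zero (mul_ne_zero hΩ0
    (Finset.prod_ne_zero_iff.mpr fun i _ => (Real.sqrt_pos.mpr (hpos i)).ne')) hΩ0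

theorem rootConj_mul_columns (hΩ : Ωᵀ * Ω = 1) (J : Finset (Fin n)) (hJ : J.card = k) :
    rootConj Ω lam * columns Ω J hJ
      = columns Ω J hJ * Matrix.diagonal (fun i => √(lam (J.orderEmbOfFin hJ i))) := by
  have h : rootConj Ω lam * Ω = Ω * Matrix.diagonal (fun i => √(lam i)) := by
    rw [rootConj, Matrix.mul_assoc, hΩ, Matrix.mul_one]
  ext a b
  have := congrFun (congrFun h a) (J.orderEmbOfFin hJ b)
  rw [Matrix.mul_diagonal] at this ⊢
  rw [Matrix.mul_apply] at this ⊢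
  simpa [columns] using this

/-- Multiplying by `Σ₀^{1/2}` turns the singular values `√λ` into `λ` and leaves the singular
vectors alone, so the formulas for the loss and its gradient apply to candidates with these explicit
data. -/
theorem isCompactSVD_rootConj_mul_candidate (hΩ : Ωᵀ * Ω = 1) (hpos : ∀ i, 0 < lam i)
    (J : Finset (Fin n)) (hJ : J.card = k) {V : Matrix (Fin m) (Fin k) ℝ} (hV : Vᵀ * V = 1) :
    IsCompactSVD (rootConj Ω lam * candidate Ω (Matrix.diagonal lam) J hJ V) (columns Ω J hJ)
      (fun i => lam (J.orderEmbOfFin hJ i)) V := by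
  refine ⟨columns_transpose_mul_columns hΩ J hJ, hV, fun _ => hpos _, ?_⟩
  rw [candidate_eq hpos, ← Matrix.mul_assoc, ← Matrix.mul_assoc, rootConj_mul_columns hΩ,
    Matrix.mul_assoc (columns Ω J hJ), Matrix.diagonal_mul_diagonal]
  simp only [Real.mul_self_sqrt (hpos _).le]

theorem candidate_eq_rootConj_mul (hΩ : Ωᵀ * Ω = 1) (hpos : ∀ i, 0 < lam i) (J : Finset (Fin n))
    (hJ : J.card = k) (V : Matrix (Fin m) (Fin k) ℝ) :
    candidate Ω (Matrix.diagonal lam) J hJ V = rootConj Ω lam * columns Ω J hJ * Vᵀ := by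
  rw [candidate_eq hpos, rootConj_mul_columns hΩ]

variable {ι : Type*} [Fintype ι] [DecidableEq ι] {U : Matrix (Fin n) ι ℝ}
  {V : Matrix (Fin m) ι ℝ} {s : ι → ℝ} {W : Matrix (Fin n) (Fin m) ℝ}

/-- The projection onto the span of the columns of `U`, in the basis given by `Ω`. -/
def projectionIn (Ω : Matrix (Fin n) (Fin n) ℝ) (U : Matrix (Fin n) ι ℝ) :
    Matrix (Fin n) (Fin n) ℝ :=
  Ωᵀ * U * (Ωᵀ * U)ᵀ

theorem transpose_projectionIn {ι : Type*} [Fintype ι] {U : Matrix (Fin n) ι ℝ} :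
    (projectionIn Ω U)ᵀ = projectionIn Ω U := by
  rw [projectionIn, Matrix.transpose_mul, Matrix.transpose_transpose]

theorem coords_orthonormal {ι : Type*} [DecidableEq ι] {U : Matrix (Fin n) ι ℝ}
    (hΩ : Ωᵀ * Ω = 1) (hU : Uᵀ * U = 1) : (Ωᵀ * U)ᵀ * (Ωᵀ * U) = 1 := by
  have hΩ' : Ω * Ωᵀ = 1 := mul_eq_one_comm.mp hΩ
  rw [Matrix.transpose_mul, Matrix.transpose_transpose, Matrix.mul_assoc, ← Matrix.mul_assoc Ω,
    hΩ', Matrix.one_mul, hU]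

theorem projectionIn_mul_self (hΩ : Ωᵀ * Ω = 1) (hU : Uᵀ * U = 1) :
    projectionIn Ω U * projectionIn Ω U = projectionIn Ω U := by
  rw [projectionIn, Matrix.mul_assoc, ← Matrix.mul_assoc (Ωᵀ * U)ᵀ, coords_orthonormal hΩ hU,
    Matrix.one_mul]

theorem trace_projectionIn (hΩ : Ωᵀ * Ω = 1) (hU : Uᵀ * U = 1) :
    ∑ i, projectionIn Ω U i i = Fintype.card ι := by
  change (projectionIn Ω U).trace = _
  rw [projectionIn, Matrix.trace_mul_comm, coords_orthonormal hΩ hU, Matrix.trace_one]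

/-- Completing the square: the inner product of `W` with `A U Vᵀ` is the nuclear norm `∑ s` of `A
W`, and `‖A U Vᵀ‖² = tr(Σ₀ U Uᵀ)`. -/
theorem lossOne_eq_of_isCompactSVD (hΩ : Ωᵀ * Ω = 1) (hpos : ∀ i, 0 < lam i)
    (h : IsCompactSVD (rootConj Ω lam * W) U s V) :
    lossOne (Ω * Matrix.diagonal lam * Ωᵀ) W
      = ((W - rootConj Ω lam * U * Vᵀ)ᵀ * (W - rootConj Ω lam * U * Vᵀ)).trace
        + ∑ i, lam i - ∑ i, lam i * projectionIn Ω U i i := by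
  set A := rootConj Ω lam with hA
  have hAt : Aᵀ = A := transpose_rootConj
  have hAA : A * A = Ω * Matrix.diagonal lam * Ωᵀ := rootConj_mul_self hΩ hpos
  rw [lossOne_eq (sqrt_eq_rootConj hΩ hpos) hAt, h.trace_sqrt,
    trace_conj_diagonal hΩ]
  have h1 : ((A * U * Vᵀ)ᵀ * W).trace = ∑ i, s i := by
    rw [← h.trace_pairing]; simp [Matrix.mul_assoc, hAt]
  have h2 : (Wᵀ * (A * U * Vᵀ)).trace = ∑ i, s i := by
    rw [← h1, ← Matrix.trace_transpose, Matrix.transpose_mul, Matrix.transpose_transpose]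
  have h3 : ((A * U * Vᵀ)ᵀ * (A * U * Vᵀ)).trace = ∑ i, lam i * projectionIn Ω U i i := by
    calc ((A * U * Vᵀ)ᵀ * (A * U * Vᵀ)).trace = (V * (Uᵀ * (A * A) * U * Vᵀ)).trace := by
          simp [Matrix.mul_assoc, hAt]
      _ = (Uᵀ * (A * A) * U * (Vᵀ * V)).trace := by
          rw [Matrix.trace_mul_comm]; simp only [Matrix.mul_assoc]
      _ = ((Ωᵀ * U)ᵀ * (Matrix.diagonal lam * (Ωᵀ * U))).trace := by
          rw [h.right_orthonormal, Matrix.mul_one, hAA]; simp [Matrix.mul_assoc]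
      _ = (Matrix.diagonal lam * projectionIn Ω U).trace := by
          rw [Matrix.trace_mul_comm, projectionIn, Matrix.mul_assoc]
      _ = _ := by simp [Matrix.trace, Matrix.diagonal_mul]
  rw [Matrix.transpose_sub, Matrix.sub_mul, Matrix.mul_sub, Matrix.mul_sub, Matrix.trace_sub,
    Matrix.trace_sub, Matrix.trace_sub, h1, h2, h3]
  ring

/-- Here `W Wᵀ = A U Uᵀ A` depends on `U` only through the projection, and that determines `W` up to
the right factor. Both the minimizers and the critical points are identified this way. -/
theorem exists_eq_candidate_of_projectionIn_eq (hΩ : Ωᵀ * Ω = 1) (hpos : ∀ i, 0 < lam i)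
    (hV : Vᵀ * V = 1) (hW : W = rootConj Ω lam * U * Vᵀ) (J : Finset (Fin n)) (hJ : J.card = k)
    (hP : projectionIn Ω U = Matrix.diagonal fun i => if i ∈ J then 1 else 0) :
    ∃ V : Matrix (Fin m) (Fin k) ℝ, Vᵀ * V = 1 ∧ W = candidate Ω (Matrix.diagonal lam) J hJ V := by
  apply exists_eq_candidate_of_mul_transpose_eq hΩ hpos
  have hAt : (rootConj Ω lam)ᵀ = rootConj Ω lam := transpose_rootConj
  calc W * Wᵀ = rootConj Ω lam * U * (Vᵀ * V) * Uᵀ * rootConj Ω lam := by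
        rw [hW]; simp [Matrix.mul_assoc, hAt]
    _ = Ω * (Matrix.diagonal (fun i => √(lam i)) * projectionIn Ω U
          * Matrix.diagonal (fun i => √(lam i))) * Ωᵀ := by
        rw [hV]; simp [projectionIn, rootConj, Matrix.mul_assoc]
    _ = _ := by
        rw [hP, Matrix.diagonal_mul_diagonal, Matrix.diagonal_mul_diagonal]
        congr 3
        funext i
        split_ifs <;> simp [Real.mul_self_sqrt (hpos i).le]

end spectral

/-! ### Minimizers and critical points -/

variable {n m k : ℕ} {Ω : Matrix (Fin n) (Fin n) ℝ} {lam : Fin n → ℝ}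
  {W : Matrix (Fin n) (Fin m) ℝ}

theorem projectionIn_columns (hΩ : Ωᵀ * Ω = 1) (J : Finset (Fin n)) (hJ : J.card = k) :
    projectionIn Ω (columns Ω J hJ) = Matrix.diagonal fun i => if i ∈ J then 1 else 0 := by
  have h := columns_conj_diagonal (Ω := Ω) J hJ fun _ => 1
  rw [Matrix.diagonal_one, Matrix.mul_one] at h
  calc projectionIn Ω (columns Ω J hJ) = Ωᵀ * (columns Ω J hJ * (columns Ω J hJ)ᵀ) * Ω := by
        simp [projectionIn, Matrix.mul_assoc]
    _ = (Ωᵀ * Ω) * Matrix.diagonal (fun i => if i ∈ J then 1 else 0) * (Ωᵀ * Ω) := by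
        rw [h]; simp only [Matrix.mul_assoc]
    _ = _ := by rw [hΩ, Matrix.one_mul, Matrix.mul_one]

theorem lossOne_candidate (hΩ : Ωᵀ * Ω = 1) (hpos : ∀ i, 0 < lam i) (J : Finset (Fin n))
    (hJ : J.card = k) {V : Matrix (Fin m) (Fin k) ℝ} (hV : Vᵀ * V = 1) :
    lossOne (Ω * Matrix.diagonal lam * Ωᵀ) (candidate Ω (Matrix.diagonal lam) J hJ V)
      = ∑ i, lam i - ∑ i ∈ J, lam i := by
  rw [lossOne_eq_of_isCompactSVD hΩ hpos (isCompactSVD_rootConj_mul_candidate hΩ hpos J hJ hV),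
    candidate_eq_rootConj_mul hΩ hpos, projectionIn_columns hΩ]
  simp

theorem rank_candidate (hΩ : Ωᵀ * Ω = 1) (hpos : ∀ i, 0 < lam i) (J : Finset (Fin n))
    (hJ : J.card = k) {V : Matrix (Fin m) (Fin k) ℝ} (hV : Vᵀ * V = 1) :
    (candidate Ω (Matrix.diagonal lam) J hJ V).rank = k := by
  rw [(isCompactSVD_candidate hΩ hpos J hJ hV).rank_eq, Fintype.card_fin]

/-- The trace of the projection is the rank of `W`, so rank at most `k` is the sum constraint of the
linear program. Equality forces both the residual `W - A U Vᵀ` to vanish and the program to be at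
its unique maximizer. -/
theorem lossOne_ge_of_rank_le (hk : 1 ≤ k) (hkn : k ≤ n) (hΩ : Ωᵀ * Ω = 1)
    (hlam : StrictAnti lam) (hpos : ∀ i, 0 < lam i) (hW : W.rank ≤ k) :
    ∑ i, lam i - ∑ i ∈ firstIndices n k, lam i ≤ lossOne (Ω * Matrix.diagonal lam * Ωᵀ) W ∧
      (lossOne (Ω * Matrix.diagonal lam * Ωᵀ) W = ∑ i, lam i - ∑ i ∈ firstIndices n k, lam i →
        ∃ V : Matrix (Fin m) (Fin k) ℝ, Vᵀ * V = 1 ∧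
          W = candidate Ω (Matrix.diagonal lam) (firstIndices n k) (card_firstIndices hkn) V) := by
  obtain ⟨ι, _, _, U, s, V, h⟩ := exists_isCompactSVD (rootConj Ω lam * W)
  have hcard : Fintype.card ι ≤ k := by
    rwa [← h.rank_eq, Matrix.rank_mul_eq_right_of_isUnit_det _ _ (isUnit_det_rootConj hΩ hpos)]
  have hMt : (projectionIn Ω U)ᵀ = projectionIn Ω U := transpose_projectionIn
  have hMM := projectionIn_mul_self hΩ h.left_orthonormal
  have hsum : ∑ i, projectionIn Ω U i i ≤ k := by
    rw [trace_projectionIn hΩ h.left_orthonormal]; exact_mod_cast hcard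
  obtain ⟨hle, heq⟩ := sum_mul_le_sum_firstIndices hk hkn hlam hpos
    (diag_nonneg_of_projection hMt hMM) (diag_le_one_of_projection hMt hMM) hsum
  have hres := trace_transpose_mul_self_nonneg (W - rootConj Ω lam * U * Vᵀ)
  rw [lossOne_eq_of_isCompactSVD hΩ hpos h]
  refine ⟨by linarith, fun hmin => ?_⟩
  have hχ := heq (by linarith)
  have hW0 : W - rootConj Ω lam * U * Vᵀ = 0 :=
    trace_transpose_mul_self_eq_zero_iff.mp (by linarith)
  refine exists_eq_candidate_of_projectionIn_eq hΩ hpos h.right_orthonormal (sub_eq_zero.mp hW0)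
    _ _ ?_
  rw [eq_diagonal_of_projection hMt hMM fun i => by rw [hχ i]; split_ifs <;> norm_num]
  congr 1
  funext i
  exact hχ i

/-- A candidate satisfies `W = A U Vᵀ`, so the gradient vanishes in every direction, tangent or not.
-/
theorem isCriticalPointOn_candidate (hΩ : Ωᵀ * Ω = 1) (hpos : ∀ i, 0 < lam i)
    (J : Finset (Fin n)) (hJ : J.card = k) {V : Matrix (Fin m) (Fin k) ℝ} (hV : Vᵀ * V = 1) :
    IsCriticalPointOn (lossOne (Ω * Matrix.diagonal lam * Ωᵀ)) (rankEq k n m)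
      (candidate Ω (Matrix.diagonal lam) J hJ V) := by
  have hd := hasFDerivWithinAt_lossOne (sqrt_eq_rootConj hΩ hpos) transpose_rootConj
    (isUnit_det_rootConj hΩ hpos) (isCompactSVD_rootConj_mul_candidate hΩ hpos J hJ hV)
  rw [Fintype.card_fin, ← candidate_eq_rootConj_mul hΩ hpos] at hd
  exact ⟨rank_candidate hΩ hpos J hJ hV, _, hd, fun H _ => by simp⟩

/-- If the loss has zero differential along `P W` for all `P`, then the left singular vectors of
`A W` are eigenvectors of `A * A`, the singular values being the eigenvalues. -/
theorem eigen_of_stationary {ι : Type*} [Fintype ι] [DecidableEq ι]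
    {A : Matrix (Fin n) (Fin n) ℝ} (hAt : Aᵀ = A) {U : Matrix (Fin n) ι ℝ} {s : ι → ℝ}
    {V : Matrix (Fin m) ι ℝ} (h : IsCompactSVD (A * W) U s V)
    (hstat : ∀ P : Matrix (Fin n) (Fin n) ℝ, ((W - A * U * Vᵀ)ᵀ * (P * W)).trace = 0) :
    A * A * U = U * Matrix.diagonal s := by
  set G := W - A * U * Vᵀ with hG
  have hGW : G * Wᵀ = 0 := by
    -- The choice `P = G Wᵀ` turns stationarity into `‖G Wᵀ‖² = 0`.
    rw [← trace_transpose_mul_self_eq_zero_iff, ← hstat (G * Wᵀ), Matrix.transpose_mul,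
      Matrix.transpose_transpose, Matrix.mul_assoc, Matrix.trace_mul_comm W]
    simp only [Matrix.mul_assoc]
  set T : Matrix ι ι ℝ := Matrix.diagonal fun i => (s i)⁻¹ with hT
  have hST : Matrix.diagonal s * T = 1 := by
    rw [hT, Matrix.diagonal_mul_diagonal, ← Matrix.diagonal_one]
    congr 1; funext i; exact mul_inv_cancel₀ (h.pos i).ne'
  -- The decomposition gives `V = (A W)ᵀ U diag(s)⁻¹`, so `G V` contains the factor `G Wᵀ`.
  have hGV : G * V = 0 := by
    calc G * V = G * (V * Matrix.diagonal s * (Uᵀ * U)) * T := by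
          rw [h.left_orthonormal, Matrix.mul_one, Matrix.mul_assoc, Matrix.mul_assoc V, hST,
            Matrix.mul_one]
      _ = G * (A * W)ᵀ * U * T := by
          rw [h.eq]; simp [Matrix.mul_assoc]
      _ = (G * Wᵀ) * A * U * T := by simp [Matrix.mul_assoc, hAt]
      _ = 0 := by rw [hGW]; simp
  have hWV : W * V = A * U := by
    have : W * V - A * U * (Vᵀ * V) = 0 := by
      rw [← hGV, hG, Matrix.sub_mul, Matrix.mul_assoc (A * U)]
    rw [h.right_orthonormal, Matrix.mul_one] at this
    exact sub_eq_zero.mp this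
  calc A * A * U = A * W * V := by rw [Matrix.mul_assoc, ← hWV, Matrix.mul_assoc]
    _ = U * Matrix.diagonal s * (Vᵀ * V) := by rw [h.eq, Matrix.mul_assoc]
    _ = _ := by rw [h.right_orthonormal, Matrix.mul_one]

/-- A projection onto a span of eigenvectors of `Ω diag(λ) Ωᵀ` is diagonal in the basis `Ω`. -/
theorem exists_projectionIn_eq_diagonal {ι : Type*} [Fintype ι] [DecidableEq ι]
    (hΩ : Ωᵀ * Ω = 1) (hlam : Function.Injective lam) {U : Matrix (Fin n) ι ℝ} {s : ι → ℝ}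
    (hU : Uᵀ * U = 1) (heig : Ω * Matrix.diagonal lam * Ωᵀ * U = U * Matrix.diagonal s) :
    ∃ J : Finset (Fin n), J.card = Fintype.card ι ∧
      projectionIn Ω U = Matrix.diagonal fun i => if i ∈ J then 1 else 0 := by
  have hMt : (projectionIn Ω U)ᵀ = projectionIn Ω U := transpose_projectionIn
  have hMM := projectionIn_mul_self hΩ hU
  have htr := trace_projectionIn hΩ hU
  set M := projectionIn Ω U with hM
  have hY : Matrix.diagonal lam * (Ωᵀ * U) = Ωᵀ * U * Matrix.diagonal s := by
    calc Matrix.diagonal lam * (Ωᵀ * U)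
        = (Ωᵀ * Ω) * (Matrix.diagonal lam * (Ωᵀ * U)) := by rw [hΩ, Matrix.one_mul]
      _ = Ωᵀ * (Ω * Matrix.diagonal lam * Ωᵀ * U) := by simp only [Matrix.mul_assoc]
      _ = _ := by rw [heig, Matrix.mul_assoc]
  -- The product equals `(Ωᵀ U) diag(s) (Ωᵀ U)ᵀ`, which is symmetric; so the two symmetric factors
  -- commute. Distinct eigenvalues then kill the off-diagonal entries.
  have hcomm : Matrix.diagonal lam * M = M * Matrix.diagonal lam := by
    have h1 : Matrix.diagonal lam * M
        = Ωᵀ * U * Matrix.diagonal s * (Ωᵀ * U)ᵀ := by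
      rw [hM, projectionIn, ← Matrix.mul_assoc, hY]
    have h2 := congrArg Matrix.transpose h1
    rw [Matrix.transpose_mul, hMt, Matrix.diagonal_transpose] at h2
    rw [h2, h1]
    simp [Matrix.mul_assoc]
  have hoff : ∀ i j, i ≠ j → M i j = 0 := by
    intro i j hij
    have := congrFun (congrFun hcomm i) j
    rw [Matrix.diagonal_mul, Matrix.mul_diagonal] at this
    have h0 : (lam i - lam j) * M i j = 0 := by linarith
    exact (mul_eq_zero.mp h0).resolve_left (sub_ne_zero.mpr (hlam.ne hij))
  have hsq : ∀ i, M i i = M i i ^ 2 := by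
    intro i
    conv_lhs => rw [diag_eq_sum_sq hMt hMM i]
    exact Finset.sum_eq_single i (fun j _ hj => by rw [hoff i j hj.symm]; norm_num) (by simp)
  have hχ : ∀ i, M i i = if i ∈ Finset.univ.filter (fun i => M i i = 1) then 1 else 0 := by
    intro i
    simp only [Finset.mem_filter, Finset.mem_univ, true_and]
    split_ifs with hi
    · exact hi
    · have h0 : M i i * (M i i - 1) = 0 := by linarith [hsq i]
      exact (mul_eq_zero.mp h0).resolve_right (sub_ne_zero.mpr hi)
  refine ⟨Finset.univ.filter fun i => M i i = 1, ?_, ?_⟩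
  · rw [Finset.sum_congr rfl fun i _ => hχ i] at htr
    rw [Finset.sum_ite_mem, Finset.univ_inter, Finset.sum_const, nsmul_eq_mul, mul_one] at htr
    exact_mod_cast htr
  · conv_lhs => rw [eq_diagonal_of_projection hMt hMM fun i => (hsq i).symm]
    congr 1
    funext i
    exact hχ i

theorem exists_eq_candidate_of_isCriticalPointOn (hΩ : Ωᵀ * Ω = 1) (hlam : StrictAnti lam)
    (hpos : ∀ i, 0 < lam i)
    (hW : IsCriticalPointOn (lossOne (Ω * Matrix.diagonal lam * Ωᵀ)) (rankEq k n m) W) :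
    ∃ (J : Finset (Fin n)) (hJ : J.card = k) (V : Matrix (Fin m) (Fin k) ℝ),
      Vᵀ * V = 1 ∧ W = candidate Ω (Matrix.diagonal lam) J hJ V := by
  obtain ⟨hrank, f', hf', hzero⟩ := hW
  have hdet := isUnit_det_rootConj hΩ hpos
  obtain ⟨ι, _, _, U, s, V, h⟩ := exists_isCompactSVD (rootConj Ω lam * W)
  have hcard : Fintype.card ι = k := by
    rw [← h.rank_eq, Matrix.rank_mul_eq_right_of_isUnit_det _ _ hdet]; exact hrank
  have hd := hasFDerivWithinAt_lossOne (sqrt_eq_rootConj hΩ hpos) transpose_rootConj hdet h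
  rw [hcard] at hd
  have hstat : ∀ P : Matrix (Fin n) (Fin n) ℝ,
      ((W - rootConj Ω lam * U * Vᵀ)ᵀ * (P * W)).trace = 0 := by
    intro P
    have hP := mul_mem_tangentConeAt_rankEq hrank P
    -- Derivatives within the rank-`k` set need agree only on its tangent cone, which is why `P * W`
    -- had to be shown tangent.
    have := hd.unique_on hf' hP
    rw [hzero _ hP, frobeniusDual_apply, Matrix.transpose_smul, Matrix.smul_mul,
      Matrix.trace_smul, smul_eq_mul] at this
    linarith
  have heig := eigen_of_stationary transpose_rootConj h hstat
  -- Substituting the eigenvector equation into the decomposition gives `A W = A (A U Vᵀ)`, and `A`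
  -- is invertible.
  have hWeq : W = rootConj Ω lam * U * Vᵀ := by
    have h1 : rootConj Ω lam * W = rootConj Ω lam * (rootConj Ω lam * U * Vᵀ) := by
      rw [← Matrix.mul_assoc, ← Matrix.mul_assoc, heig]; exact h.eq
    have h2 := congrArg ((rootConj Ω lam)⁻¹ * ·) h1
    simpa only [← Matrix.mul_assoc, Matrix.nonsing_inv_mul _ hdet, Matrix.one_mul] using h2
  rw [rootConj_mul_self hΩ hpos] at heig
  obtain ⟨J, hJ, hP⟩ :=
    exists_projectionIn_eq_diagonal hΩ hlam.injective h.left_orthonormal heig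
  exact ⟨J, hJ.trans hcard,
    exists_eq_candidate_of_projectionIn_eq hΩ hpos h.right_orthonormal hWeq J _ hP⟩

theorem differentiableOn_lossOne_rankEq (hΩ : Ωᵀ * Ω = 1) (hpos : ∀ i, 0 < lam i) :
    DifferentiableOn ℝ (lossOne (Ω * Matrix.diagonal lam * Ωᵀ)) (rankEq k n m) := by
  intro W hW
  have hdet := isUnit_det_rootConj hΩ hpos
  obtain ⟨ι, _, _, U, s, V, h⟩ := exists_isCompactSVD (rootConj Ω lam * W)
  have hcard : Fintype.card ι = k := by
    rw [← h.rank_eq, Matrix.rank_mul_eq_right_of_isUnit_det _ _ hdet]; exact hW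
  have hd := hasFDerivWithinAt_lossOne (sqrt_eq_rootConj hΩ hpos) transpose_rootConj hdet h
  rw [hcard] at hd
  exact ⟨_, hd⟩

theorem exists_orthonormal_columns (hkm : k ≤ m) : ∃ V : Matrix (Fin m) (Fin k) ℝ, Vᵀ * V = 1 := by
  refine ⟨(1 : Matrix (Fin m) (Fin m) ℝ).submatrix id (Fin.castLE hkm), ?_⟩
  rw [Matrix.transpose_submatrix, Matrix.transpose_one,
    ← Matrix.submatrix_mul _ _ _ _ _ Function.bijective_id, Matrix.mul_one]
  exact Matrix.submatrix_one _ (Fin.castLE_injective hkm)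

/-- The indicator of `J` is feasible for the linear program, whose maximizer is unique. -/
theorem sum_lt_sum_firstIndices (hk : 1 ≤ k) (hkn : k ≤ n) (hlam : StrictAnti lam)
    (hpos : ∀ i, 0 < lam i) {J : Finset (Fin n)} (hJ : J.card = k) (hne : J ≠ firstIndices n k) :
    ∑ i ∈ J, lam i < ∑ i ∈ firstIndices n k, lam i := by
  have hsum : ∑ i, lam i * (if i ∈ J then 1 else 0) = ∑ i ∈ J, lam i := by simp
  obtain ⟨hle, heq⟩ := sum_mul_le_sum_firstIndices hk hkn hlam hpos
    (p := fun i => if i ∈ J then 1 else 0) (fun i => by split_ifs <;> norm_num)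
    (fun i => by split_ifs <;> norm_num) (by simp [hJ])
  rw [hsum] at hle heq
  refine hle.lt_of_ne fun h => hne ?_
  ext i
  have := heq h i
  by_cases h1 : i ∈ J <;> by_cases h2 : i ∈ firstIndices n k <;> simp_all

end BuresWasserstein

open BuresWasserstein in
theorem mainTheorem1 {n m k : ℕ} (hk : 1 ≤ k) (hkn : k ≤ n) (hkm : k ≤ m)
    (S₀ Ω : Matrix (Fin n) (Fin n) ℝ) (lam : Fin n → ℝ)
    (hΩ : Ω ∈ Matrix.orthogonalGroup (Fin n) ℝ)
    (hlam : StrictAnti lam) (hpos : ∀ i, 0 < lam i)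
    (hS₀ : S₀ = Ω * Matrix.diagonal lam * Ωᵀ) :
    -- the restriction of the loss to the rank-`k` matrices is differentiable
    DifferentiableOn ℝ (lossOne S₀) (rankEq k n m) ∧
    -- its critical points
    (∀ W : Matrix (Fin n) (Fin m) ℝ,
      IsCriticalPointOn (lossOne S₀) (rankEq k n m) W ↔
        ∃ (J : Finset (Fin n)) (hJ : J.card = k) (V : Matrix (Fin m) (Fin k) ℝ),
          Vᵀ * V = 1 ∧ W = candidate Ω (Matrix.diagonal lam) J hJ V) ∧
    -- a critical point is a minimizer over rank at most `k` precisely when its index set is `[k]`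
    (∀ (J : Finset (Fin n)) (hJ : J.card = k) (V : Matrix (Fin m) (Fin k) ℝ), Vᵀ * V = 1 →
      (IsMinOn (lossOne S₀) (rankLE k n m) (candidate Ω (Matrix.diagonal lam) J hJ V) ↔
        J = firstIndices n k)) ∧
    -- and these are all the minimizers over rank at most `k`
    (∀ W : Matrix (Fin n) (Fin m) ℝ,
      (W ∈ rankLE k n m ∧ IsMinOn (lossOne S₀) (rankLE k n m) W) ↔
        ∃ V : Matrix (Fin m) (Fin k) ℝ, Vᵀ * V = 1 ∧
          W = candidate Ω (Matrix.diagonal lam) (firstIndices n k) (card_firstIndices hkn) V) ∧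
    -- the infimum over rank `k` is a minimum, equal to the minimum over rank at most `k`
    (∃ c : ℝ, IsGLB (lossOne S₀ '' rankEq k n m) c ∧ IsLeast (lossOne S₀ '' rankEq k n m) c ∧
      IsLeast (lossOne S₀ '' rankLE k n m) c) := by
  subst hS₀
  have hΩ' : Ωᵀ * Ω = 1 := (Matrix.mem_orthogonalGroup_iff' (Fin n) ℝ).mp hΩ
  have hbound := fun (W : Matrix (Fin n) (Fin m) ℝ) (hW : W ∈ rankLE k n m) =>
    lossOne_ge_of_rank_le hk hkn hΩ' hlam hpos hW
  -- This uses `k ≤ m`; the resulting candidate witnesses that the lower bound is attained, already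
  -- at rank exactly `k`.
  obtain ⟨V₀, hV₀⟩ := exists_orthonormal_columns hkm
  have hval := fun (J : Finset (Fin n)) (hJ : J.card = k) (V : Matrix (Fin m) (Fin k) ℝ)
    (hV : Vᵀ * V = 1) => lossOne_candidate hΩ' hpos J hJ hV
  have hrank := fun (J : Finset (Fin n)) (hJ : J.card = k) (V : Matrix (Fin m) (Fin k) ℝ)
    (hV : Vᵀ * V = 1) => rank_candidate hΩ' hpos J hJ hV
  have hmin : ∀ V : Matrix (Fin m) (Fin k) ℝ, Vᵀ * V = 1 →
      IsMinOn (lossOne (Ω * Matrix.diagonal lam * Ωᵀ)) (rankLE k n m)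
        (candidate Ω (Matrix.diagonal lam) (firstIndices n k) (card_firstIndices hkn) V) := by
    intro V hV Y hY
    change _ ≤ lossOne _ Y
    rw [hval _ _ V hV]
    exact (hbound Y hY).1
  have hleast : ∀ M : Set (Matrix (Fin n) (Fin m) ℝ), M ⊆ rankLE k n m → rankEq k n m ⊆ M →
      IsLeast (lossOne (Ω * Matrix.diagonal lam * Ωᵀ) '' M)
        (∑ i, lam i - ∑ i ∈ firstIndices n k, lam i) := by
    intro M hM hM'
    refine ⟨⟨_, hM' (hrank _ (card_firstIndices hkn) V₀ hV₀), hval _ _ V₀ hV₀⟩, ?_⟩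
    rintro _ ⟨Y, hY, rfl⟩
    exact (hbound Y (hM hY)).1
  have hsub : rankEq k n m ⊆ rankLE k n m := fun Y hY => le_of_eq hY
  refine ⟨differentiableOn_lossOne_rankEq hΩ' hpos, fun W => ⟨fun h => ?_, ?_⟩,
    fun J hJ V hV => ⟨fun h => ?_, ?_⟩, fun W => ⟨fun ⟨hW, h⟩ => ?_, ?_⟩,
    _, (hleast _ hsub subset_rfl).isGLB, hleast _ hsub subset_rfl, hleast _ subset_rfl hsub⟩
  · exact exists_eq_candidate_of_isCriticalPointOn hΩ' hlam hpos h
  · rintro ⟨J, hJ, V, hV, rfl⟩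
    exact isCriticalPointOn_candidate hΩ' hpos J hJ hV
  · by_contra hne
    have h1 := h (hsub (hrank _ (card_firstIndices hkn) V₀ hV₀))
    change lossOne _ _ ≤ lossOne _ _ at h1
    rw [hval _ _ V hV, hval _ _ V₀ hV₀] at h1
    linarith [sum_lt_sum_firstIndices hk hkn hlam hpos hJ hne]
  · rintro rfl
    exact hmin V hV
  · have h1 := h (hsub (hrank _ (card_firstIndices hkn) V₀ hV₀))
    change lossOne _ _ ≤ lossOne _ _ at h1
    rw [hval _ _ V₀ hV₀] at h1
    exact (hbound W hW).2 (le_antisymm h1 (hbound W hW).1)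
  · rintro ⟨V, hV, rfl⟩
    exact ⟨hsub (hrank _ _ V hV), hmin V hV⟩
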